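/- For $\alpha,\beta>0$ and $z\in\mathbb{R}$ let $$E_{\alpha,\beta}(z)=\sum_{n\ge 0}\frac{z^n}{\Gamma(\beta+\alpha n)}$$ be the two-parameter Mittag-Leffler function. For every $\alpha\in(0,1]$ and every real $x\neq 0$, the map $$\beta\;\mapsto\;\Gamma(\beta)\,E_{\alpha,\beta}\!\left(\frac{\Gamma(\beta+\alpha)}{\Gamma(\beta)}\,x\right)$$ is strictly increasing on $(\alpha,\infty)$. Moreover, as $\beta\to\infty$, it tends to $\infty$ if $x\ge 1$ and to $1/(1-x)$ if $x<1$. -/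

import Mathlib

/-- The two-parameter Mittag-Leffler function
`E_{α,β}(x) = ∑_{n ≥ 0} x ^ n / Γ(β + α n)`, of a real variable `x`, for `α, β > 0`. -/
noncomputable def mittagLeffler (α β x : ℝ) : ℝ :=
  ∑' n : ℕ, x ^ n / Real.Gamma (β + α * n)

/-- A lower bound on the Gamma function, from its integral restricted to `(R, ∞)`. -/
theorem rpow_mul_exp_neg_le_Gamma {R s : ℝ} (hR : 0 < R) (hs : 1 ≤ s) :
    R ^ (s - 1) * Real.exp (-R) ≤ Real.Gamma s := by
  have hs0 : 0 < s := by linarith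
  have hI := Real.GammaIntegral_convergent hs0
  have hsub : Set.Ioi R ⊆ Set.Ioi (0 : ℝ) := Set.Ioi_subset_Ioi hR.le
  rw [Real.Gamma_eq_integral hs0]
  calc R ^ (s - 1) * Real.exp (-R)
      = ∫ t in Set.Ioi R, R ^ (s - 1) * Real.exp (-t) := by
        rw [MeasureTheory.integral_const_mul, integral_exp_neg_Ioi]
    _ ≤ ∫ t in Set.Ioi R, Real.exp (-t) * t ^ (s - 1) := by
        refine MeasureTheory.setIntegral_mono_on
          ((integrableOn_exp_neg_Ioi R).const_mul _) (hI.mono_set hsub) measurableSet_Ioi ?_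
        intro t ht
        rw [mul_comm]
        exact mul_le_mul_of_nonneg_left
          (Real.rpow_le_rpow hR.le (Set.mem_Ioi.mp ht).le (by linarith)) (Real.exp_pos _).le
    _ ≤ ∫ t in Set.Ioi (0 : ℝ), Real.exp (-t) * t ^ (s - 1) := by
        refine MeasureTheory.setIntegral_mono_set hI ?_ hsub.eventuallyLE
        filter_upwards [MeasureTheory.ae_restrict_mem measurableSet_Ioi] with t ht
        exact mul_nonneg (Real.exp_pos _).le (Real.rpow_nonneg (Set.mem_Ioi.mp ht).le _)

/-- The Mittag-Leffler series converges for every real `x`. -/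
theorem summable_mittagLeffler {α : ℝ} (hα : 0 < α) (β x : ℝ) :
    Summable fun n : ℕ => x ^ n / Real.Gamma (β + α * n) := by
  set M : ℝ := 2 * |x| + 1 with hM
  have hx0 := abs_nonneg x
  have hM0 : 0 < M := by positivity
  set R : ℝ := M ^ α⁻¹ with hRdef
  have hR : 0 < R := Real.rpow_pos_of_pos hM0 _
  have hRα : R ^ α = M := by
    rw [hRdef, ← Real.rpow_mul hM0.le, inv_mul_cancel₀ hα.ne', Real.rpow_one]
  have hr : |x| / M < 1 := by rw [div_lt_one hM0]; linarith
  have hg : Summable fun n : ℕ => (R ^ (β - 1) * Real.exp (-R))⁻¹ * (|x| / M) ^ n :=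
    (summable_geometric_of_lt_one (by positivity) hr).mul_left _
  refine Summable.of_norm_bounded_eventually_nat hg ?_
  obtain ⟨N, hN⟩ := exists_nat_ge ((1 - β) / α)
  filter_upwards [Filter.eventually_ge_atTop N] with n hn
  have hs : 1 ≤ β + α * n := by
    have h1 : (1 - β) / α ≤ n := hN.trans (by exact_mod_cast hn)
    rw [div_le_iff₀ hα] at h1
    linarith
  have hle := rpow_mul_exp_neg_le_Gamma hR hs
  have hpow : R ^ (β + α * n - 1) = R ^ (β - 1) * M ^ n := by
    rw [← hRα, ← Real.rpow_natCast (R ^ α), ← Real.rpow_mul hR.le, ← Real.rpow_add hR]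
    ring_nf
  rw [hpow] at hle
  have hc : 0 < R ^ (β - 1) * M ^ n * Real.exp (-R) := by positivity
  have hG := lt_of_lt_of_le hc hle
  rw [norm_div, norm_pow, Real.norm_eq_abs, Real.norm_eq_abs, abs_of_pos hG]
  calc |x| ^ n / Real.Gamma (β + α * n)
      ≤ |x| ^ n / (R ^ (β - 1) * M ^ n * Real.exp (-R)) := by gcongr
    _ = (R ^ (β - 1) * Real.exp (-R))⁻¹ * (|x| / M) ^ n := by
        rw [div_pow]; field_simp

/-! For `0 < α ≤ 1` and `β ≥ α`, the function E(α,β;·) is nonnegative, increasing and convex on the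
whole line. This is proved by discretisation. The sum over n of y^n (1-z)^(-β-αn) is F = (1-z)^(-β)
/ (1 - y(1-z)^(-α)), so ((1-z)^α - y) F = (1-z)^(α-β). Apart from its constant term, (1-z)^α has
nonpositive coefficients. Comparing coefficients of z^N therefore gives F_N as 1/(1-y) times a
nonnegative combination of earlier F_k plus a nonnegative constant, and all three properties follow
by induction. With y replaced by y N^(-α), the rescaled coefficients tend to E(α,β;y) by Gauss's
limit for Γ. Analyticity makes the convexity strict.

Monotonicity in β is then Jensen's inequality: if B has the Beta(β, γ-β) law, Γ(γ)E(α,γ;y) is the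
mean of Γ(β)E(α,β;yB^α). The normalisation Γ(β+α)/Γ(β) is exactly what makes the arguments on the
two sides agree in mean.

For the limits, log-convexity of Γ bounds the normalized Taylor coefficients by 1, and each tends to
1; this settles x ≥ 1 and |x| < 1. For x = -l < 0, the Laplace transform of t^(β-1)E(α,β;-t^α)
exhibits 1/(1+l) as a mean of Γ(β)E(α,β;-T^α) over a Gamma variable T, and T^α concentrates at its
mean. -/

/-! ### Negative binomial coefficients. -/

/-- The coefficients of the power series `(1 - z) ^ (-s)`. -/
noncomputable def negBinomCoeff (s : ℝ) (N : ℕ) : ℝ :=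
  (∏ j ∈ Finset.range N, (s + j)) / N.factorial

theorem negBinomCoeff_zero (s : ℝ) : negBinomCoeff s 0 = 1 := by simp [negBinomCoeff]

theorem succ_mul_negBinomCoeff_succ (s : ℝ) (N : ℕ) :
    ((N : ℝ) + 1) * negBinomCoeff s (N + 1) = (s + N) * negBinomCoeff s N := by
  have h : (N.factorial : ℝ) ≠ 0 := by positivity
  have h' : (N : ℝ) + 1 ≠ 0 := by positivity
  rw [negBinomCoeff, negBinomCoeff, Finset.prod_range_succ, Nat.factorial_succ]
  push_cast
  field_simp

/-- The Cauchy product (1-z)^(-s) (1-z)^(-t) = (1-z)^(-s-t). Multiplying by N + 1 = p.1 + p.2 lets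
the one-step recurrence act on either factor. -/
theorem negBinomCoeff_add (s t : ℝ) (N : ℕ) :
    ∑ p ∈ Finset.HasAntidiagonal.antidiagonal N, negBinomCoeff s p.1 * negBinomCoeff t p.2
      = negBinomCoeff (s + t) N := by
  induction N with
  | zero => simp [negBinomCoeff_zero]
  | succ N ih =>
    have h' : (N : ℝ) + 1 ≠ 0 := by positivity
    apply mul_left_cancel₀ h'
    rw [succ_mul_negBinomCoeff_succ, ← ih]
    have h1 : ∑ p ∈ Finset.HasAntidiagonal.antidiagonal (N + 1),
        (p.1 : ℝ) * (negBinomCoeff s p.1 * negBinomCoeff t p.2)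
        = ∑ p ∈ Finset.HasAntidiagonal.antidiagonal N,
          (s + p.1) * (negBinomCoeff s p.1 * negBinomCoeff t p.2) := by
      rw [Finset.Nat.sum_antidiagonal_succ]
      simp only [Nat.cast_zero, zero_mul, zero_add]
      refine Finset.sum_congr rfl fun p _ => ?_
      push_cast
      rw [← mul_assoc, succ_mul_negBinomCoeff_succ, mul_assoc]
    have h2 : ∑ p ∈ Finset.HasAntidiagonal.antidiagonal (N + 1),
        (p.2 : ℝ) * (negBinomCoeff s p.1 * negBinomCoeff t p.2)
        = ∑ p ∈ Finset.HasAntidiagonal.antidiagonal N,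
          (t + p.2) * (negBinomCoeff s p.1 * negBinomCoeff t p.2) := by
      rw [Finset.Nat.sum_antidiagonal_succ']
      simp only [Nat.cast_zero, zero_mul, zero_add]
      refine Finset.sum_congr rfl fun p _ => ?_
      push_cast
      rw [mul_left_comm, succ_mul_negBinomCoeff_succ]
      ring
    calc ((N : ℝ) + 1) * ∑ p ∈ Finset.HasAntidiagonal.antidiagonal (N + 1),
          negBinomCoeff s p.1 * negBinomCoeff t p.2
        = ∑ p ∈ Finset.HasAntidiagonal.antidiagonal (N + 1),
            ((p.1 : ℝ) * (negBinomCoeff s p.1 * negBinomCoeff t p.2)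
              + (p.2 : ℝ) * (negBinomCoeff s p.1 * negBinomCoeff t p.2)) := by
          rw [Finset.mul_sum]
          refine Finset.sum_congr rfl fun p hp => ?_
          have : (p.1 : ℝ) + p.2 = N + 1 := by
            exact_mod_cast Finset.HasAntidiagonal.mem_antidiagonal.mp hp
          rw [← this]; ring
      _ = _ := by
          rw [Finset.sum_add_distrib, h1, h2, ← Finset.sum_add_distrib, Finset.mul_sum]
          refine Finset.sum_congr rfl fun p hp => ?_
          have : (p.1 : ℝ) + p.2 = N := by exact_mod_cast Finset.HasAntidiagonal.mem_antidiagonal.mp hp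
          rw [← this]; ring

theorem negBinomCoeff_nonneg {s : ℝ} (hs : 0 ≤ s) (N : ℕ) : 0 ≤ negBinomCoeff s N := by
  unfold negBinomCoeff; positivity

/-- Only the factor with j = 0 is negative; the others are j - α with j ≥ 1. This sign is where `α ≤
1` enters. -/
theorem negBinomCoeff_neg_nonpos {α : ℝ} (h0 : 0 ≤ α) (h1 : α ≤ 1) (N : ℕ) :
    negBinomCoeff (-α) (N + 1) ≤ 0 := by
  rw [negBinomCoeff, Finset.prod_range_succ']
  refine div_nonpos_of_nonpos_of_nonneg (mul_nonpos_of_nonneg_of_nonpos ?_ (by simpa)) (by positivity)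
  refine Finset.prod_nonneg fun j _ => ?_
  push_cast
  have : (0 : ℝ) ≤ j := by positivity
  linarith

theorem negBinomCoeff_le {s : ℝ} (hs : 0 ≤ s) (N : ℕ) : negBinomCoeff s N ≤ (s + N) ^ N := by
  have h1 : (1 : ℝ) ≤ N.factorial := by exact_mod_cast Nat.one_le_iff_ne_zero.mpr N.factorial_ne_zero
  refine (div_le_self (by positivity) h1).trans ?_
  calc ∏ j ∈ Finset.range N, (s + j) ≤ ∏ j ∈ Finset.range N, (s + N) := by
        refine Finset.prod_le_prod (fun _ _ => by positivity) fun j hj => ?_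
        have : (j : ℝ) ≤ N := by exact_mod_cast (Finset.mem_range.mp hj).le
        linarith
    _ = _ := by simp

theorem summable_pow_mul_negBinomCoeff {α β : ℝ} (hα : 0 ≤ α) (hβ : 0 ≤ β) (N : ℕ) {y : ℝ}
    (hy : |y| < 1) : Summable fun n : ℕ => y ^ n * negBinomCoeff (β + α * n) N := by
  have h := (summable_pow_mul_geometric_of_norm_lt_one N (r := |y|) (by simpa using hy)).mul_left
    ((β + α + N) ^ N)
  refine Summable.of_norm_bounded_eventually_nat h ?_
  filter_upwards [Filter.eventually_ge_atTop 1] with n hn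
  have hn' : (1 : ℝ) ≤ n := by exact_mod_cast hn
  have hc := negBinomCoeff_le (s := β + α * n) (by positivity) N
  rw [norm_mul, norm_pow, Real.norm_eq_abs, Real.norm_eq_abs,
    abs_of_nonneg (negBinomCoeff_nonneg (by positivity) N)]
  calc |y| ^ n * negBinomCoeff (β + α * n) N
      ≤ |y| ^ n * (β + α * n + N) ^ N := by gcongr
    _ ≤ |y| ^ n * ((β + α + N) * n) ^ N := by
        gcongr
        have hN : (0 : ℝ) ≤ N := by positivity
        nlinarith
    _ = _ := by rw [mul_pow]; ring

/-! ### Gauss's approximants of Γ. -/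

theorem negBinomCoeff_succ_eq {s : ℝ} (hs : 0 < s) {N : ℕ} (hN : 0 < N) :
    (N + 1) * (N : ℝ) ^ (-s) * negBinomCoeff s (N + 1) = 1 / Real.GammaSeq s N := by
  have hN' : (0 : ℝ) < N := by exact_mod_cast hN
  have hp : 0 < ∏ j ∈ Finset.range (N + 1), (s + j) := by positivity
  have h : (N.factorial : ℝ) ≠ 0 := by positivity
  have h' : (N : ℝ) + 1 ≠ 0 := by positivity
  rw [negBinomCoeff, Real.GammaSeq, Real.rpow_neg hN'.le, Nat.factorial_succ]
  have := (Real.rpow_pos_of_pos hN' s).ne'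
  push_cast
  field_simp

theorem GammaSeq_pos {s : ℝ} (hs : 0 < s) {N : ℕ} (hN : 0 < N) : 0 < Real.GammaSeq s N := by
  have hN' : (0 : ℝ) < N := by exact_mod_cast hN
  unfold Real.GammaSeq
  positivity

/-- Amounts to (1 + 1/N)^s ≥ 1 + s/(N+1), from log(1 + 1/N) ≥ 1/(N+1). The monotonicity lets a
single index dominate all later ones in the limit of series. -/
theorem GammaSeq_le_succ {s : ℝ} (hs : 0 < s) {N : ℕ} (hN : 0 < N) :
    Real.GammaSeq s N ≤ Real.GammaSeq s (N + 1) := by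
  have hN' : (0 : ℝ) < N := by exact_mod_cast hN
  have hp : 0 < ∏ j ∈ Finset.range (N + 1), (s + j) := by positivity
  have hlog : 1 / ((N : ℝ) + 1) ≤ Real.log ((N + 1) / N) := by
    have h := Real.one_sub_inv_le_log_of_pos (x := ((N : ℝ) + 1) / N) (by positivity)
    refine le_trans (le_of_eq ?_) h
    field_simp
    ring
  have hkey : (N : ℝ) ^ s * (s + (N + 1)) ≤ ((N : ℝ) + 1) ^ s * (N + 1) := by
    have h1 : 1 + s / (N + 1) ≤ (((N : ℝ) + 1) / N) ^ s := by
      rw [Real.rpow_def_of_pos (by positivity)]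
      refine le_trans ?_ (Real.add_one_le_exp _)
      have : s / (N + 1) = 1 / ((N : ℝ) + 1) * s := by ring
      nlinarith
    rw [Real.div_rpow (by positivity) hN'.le, le_div_iff₀ (by positivity)] at h1
    have h2 : (N : ℝ) ^ s * (s + (N + 1)) = (1 + s / (N + 1)) * (N : ℝ) ^ s * (N + 1) := by
      field_simp; ring
    rw [h2]
    gcongr
  rw [Real.GammaSeq, Real.GammaSeq, Finset.prod_range_succ _ (N + 1), Nat.factorial_succ]
  push_cast
  rw [div_le_div_iff₀ hp (by positivity)]
  calc (N : ℝ) ^ s * N.factorial * ((∏ j ∈ Finset.range (N + 1), (s + j)) * (s + (N + 1)))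
      = (N : ℝ) ^ s * (s + (N + 1)) * (N.factorial * (∏ j ∈ Finset.range (N + 1), (s + j))) := by
        ring
    _ ≤ ((N : ℝ) + 1) ^ s * (N + 1)
          * (N.factorial * (∏ j ∈ Finset.range (N + 1), (s + j))) := by gcongr
    _ = _ := by ring

theorem GammaSeq_mono {s : ℝ} (hs : 0 < s) {M N : ℕ} (hM : 0 < M) (hMN : M ≤ N) :
    Real.GammaSeq s M ≤ Real.GammaSeq s N := by
  induction N, hMN using Nat.le_induction with
  | base => exact le_rfl
  | succ N hMN ih => exact ih.trans (GammaSeq_le_succ hs (hM.trans_le hMN))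

/-! ### The discrete model and its shape. -/

/-- The coefficient of `z ^ N` in `(1 - z) ^ (-β) / (1 - y * (1 - z) ^ (-α))`. -/
noncomputable def discreteMittagLeffler (α β : ℝ) (N : ℕ) (y : ℝ) : ℝ :=
  ∑' n : ℕ, y ^ n * negBinomCoeff (β + α * n) N

/-- The coefficient of z^N in ((1-z)^α - y) F = (1-z)^(α-β), solved for F_N. Multiplying by (1-z)^α
shifts the series over n by one step, leaving the n = 0 term. -/
theorem discreteMittagLeffler_rec {α β : ℝ} (hα : 0 ≤ α) (hβ : α ≤ β) (N : ℕ) {y : ℝ}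
    (hy : |y| < 1) :
    discreteMittagLeffler α β N y = (1 - y)⁻¹ * (negBinomCoeff (β - α) N +
      ∑ k ∈ Finset.range N,
        -negBinomCoeff (-α) (k + 1) * discreteMittagLeffler α β (N - (k + 1)) y) := by
  have hβ0 : 0 ≤ β := hα.trans hβ
  have hs := fun M => summable_pow_mul_negBinomCoeff hα hβ0 M hy
  have key : ∑ p ∈ Finset.HasAntidiagonal.antidiagonal N,
      negBinomCoeff (-α) p.1 * discreteMittagLeffler α β p.2 y
      = negBinomCoeff (β - α) N + y * discreteMittagLeffler α β N y := by
    have e1 : ∑ p ∈ Finset.HasAntidiagonal.antidiagonal N,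
        negBinomCoeff (-α) p.1 * discreteMittagLeffler α β p.2 y
        = ∑' n : ℕ, y ^ n * negBinomCoeff (β - α + α * n) N := by
      simp only [discreteMittagLeffler, ← tsum_mul_left]
      have hsw := Summable.tsum_finsetSum (s := Finset.HasAntidiagonal.antidiagonal N)
        fun (p : ℕ × ℕ) _ => (hs p.2).mul_left (negBinomCoeff (-α) p.1)
      rw [← hsw]
      refine tsum_congr fun n => ?_
      have : β - α + α * n = -α + (β + α * n) := by ring
      rw [this, ← negBinomCoeff_add, Finset.mul_sum]
      exact Finset.sum_congr rfl fun p _ => by ring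
    rw [e1, Summable.tsum_eq_zero_add
      (summable_pow_mul_negBinomCoeff hα (sub_nonneg.mpr hβ) N hy)]
    simp only [discreteMittagLeffler, ← tsum_mul_left]
    simp only [pow_zero, one_mul, Nat.cast_zero, mul_zero, add_zero]
    congr 1
    refine tsum_congr fun n => ?_
    rw [pow_succ']
    push_cast
    rw [show β - α + α * ((n : ℝ) + 1) = β + α * n by ring, mul_assoc]
  rw [Finset.Nat.sum_antidiagonal_eq_sum_range_succ
    (fun i j => negBinomCoeff (-α) i * discreteMittagLeffler α β j y),
    Finset.sum_range_succ', negBinomCoeff_zero, one_mul, Nat.sub_zero] at key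
  have h1 : 1 - y ≠ 0 := by
    have := (abs_lt.mp hy).2
    linarith
  rw [eq_inv_mul_iff_mul_eq₀ h1]
  simp only [neg_mul, Finset.sum_neg_distrib]
  linarith

/-- The three properties go through the induction together: a product of nonnegative convex
functions is convex here because both factors increase. -/
theorem discreteMittagLeffler_convex_mono_nonneg {α β : ℝ} (hα : 0 ≤ α) (hα1 : α ≤ 1)
    (hβ : α ≤ β) (N : ℕ) :
    ConvexOn ℝ (Set.Ioo (-1) 1) (discreteMittagLeffler α β N) ∧
      MonotoneOn (discreteMittagLeffler α β N) (Set.Ioo (-1) 1) ∧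
      ∀ y ∈ Set.Ioo (-1 : ℝ) 1, 0 ≤ discreteMittagLeffler α β N y := by
  induction N using Nat.strong_induction_on with
  | _ N ih =>
  have hconv : Convex ℝ (Set.Ioo (-1 : ℝ) 1) := convex_Ioo _ _
  have hpos : ∀ y ∈ Set.Ioo (-1 : ℝ) 1, 0 < 1 - y := fun y hy => by linarith [hy.2]
  have hg : ConvexOn ℝ (Set.Ioo (-1 : ℝ) 1) fun y => (1 - y)⁻¹ := by
    refine ⟨hconv, fun x hx y hy a b ha hb hab => ?_⟩
    have h := (convexOn_zpow (𝕜 := ℝ) (-1)).2 (hpos x hx) (hpos y hy) ha hb hab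
    simp only [zpow_neg, zpow_one] at h
    refine le_trans (le_of_eq ?_) h
    simp only [smul_eq_mul]
    congr 1
    linear_combination -hab
  have hgm : MonotoneOn (fun y : ℝ => (1 - y)⁻¹) (Set.Ioo (-1 : ℝ) 1) := fun x hx y hy hxy => by
    have := hpos y hy
    show (1 - x)⁻¹ ≤ (1 - y)⁻¹
    gcongr
  set S : ℝ → ℝ := fun y => negBinomCoeff (β - α) N + ∑ k ∈ Finset.range N,
      -negBinomCoeff (-α) (k + 1) * discreteMittagLeffler α β (N - (k + 1)) y with hS
  have hp : ∀ k, 0 ≤ -negBinomCoeff (-α) (k + 1) := fun k =>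
    neg_nonneg.mpr (negBinomCoeff_neg_nonpos hα hα1 k)
  have hih : ∀ k ∈ Finset.range N, N - (k + 1) < N := fun k hk => by
    have := Finset.mem_range.mp hk
    omega
  have hSn : ∀ y ∈ Set.Ioo (-1 : ℝ) 1, 0 ≤ S y := fun y hy =>
    add_nonneg (negBinomCoeff_nonneg (sub_nonneg.mpr hβ) N)
      (Finset.sum_nonneg fun k hk => mul_nonneg (hp k) ((ih _ (hih k hk)).2.2 y hy))
  have hSm : MonotoneOn S (Set.Ioo (-1 : ℝ) 1) := fun x hx y hy hxy => by
    refine add_le_add_right (Finset.sum_le_sum fun k hk => ?_) _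
    exact mul_le_mul_of_nonneg_left ((ih _ (hih k hk)).2.1 hx hy hxy) (hp k)
  have hSc : ConvexOn ℝ (Set.Ioo (-1 : ℝ) 1) S := by
    refine ⟨hconv, fun x hx y hy a b ha hb hab => ?_⟩
    simp only [hS, smul_eq_mul, mul_add, Finset.mul_sum]
    have e : ∀ u v w z : ℝ, u + v + (w + z) = u + w + (v + z) := fun _ _ _ _ => by ring
    rw [e, ← add_mul, hab, one_mul, ← Finset.sum_add_distrib]
    refine add_le_add_right (Finset.sum_le_sum fun k hk => ?_) _
    have h := mul_le_mul_of_nonneg_left ((ih _ (hih k hk)).1.2 hx hy ha hb hab) (hp k)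
    simp only [smul_eq_mul] at h
    linarith
  have heq : Set.EqOn (fun y => (1 - y)⁻¹ * S y) (discreteMittagLeffler α β N)
      (Set.Ioo (-1 : ℝ) 1) := fun y hy =>
    (discreteMittagLeffler_rec hα hβ N (abs_lt.mpr hy)).symm
  refine ⟨?_, ?_, ?_⟩
  · refine ConvexOn.congr ?_ heq
    exact hg.mul hSc (fun y hy => (inv_pos.mpr (hpos y hy)).le) (fun y hy => hSn y hy)
      (hgm.monovaryOn hSm)
  · refine MonotoneOn.congr ?_ heq
    exact hgm.mul hSm (fun y hy => (inv_pos.mpr (hpos y hy)).le) (fun y hy => hSn y hy)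
  · intro y hy
    rw [← heq hy]
    exact mul_nonneg (inv_pos.mpr (hpos y hy)).le (hSn y hy)

/-! ### Passage to the limit. -/

theorem scaled_discreteMittagLeffler_term {α β : ℝ} (hα : 0 ≤ α) (hβ : 0 < β) {N : ℕ}
    (hN : 0 < N) (y : ℝ) (n : ℕ) :
    (N + 1) * (N : ℝ) ^ (-β) * ((y * (N : ℝ) ^ (-α)) ^ n * negBinomCoeff (β + α * n) (N + 1))
      = y ^ n / Real.GammaSeq (β + α * n) N := by
  have hN' : (0 : ℝ) < N := by exact_mod_cast hN
  have h := negBinomCoeff_succ_eq (s := β + α * n) (by positivity) hN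
  rw [div_eq_mul_one_div, ← h, mul_pow, ← Real.rpow_natCast ((N : ℝ) ^ (-α)),
    ← Real.rpow_mul hN'.le, show -(β + α * n) = -β + -α * n by ring, Real.rpow_add hN']
  ring

theorem tendsto_scaled_discreteMittagLeffler {α β : ℝ} (hα : 0 < α) (hβ : 0 < β) (y : ℝ) :
    Filter.Tendsto (fun N : ℕ => (N + 1) * (N : ℝ) ^ (-β) *
        discreteMittagLeffler α β (N + 1) (y * (N : ℝ) ^ (-α)))
      Filter.atTop (nhds (mittagLeffler α β y)) := by
  have hlim : Filter.Tendsto (fun N : ℕ => |y| * (N : ℝ) ^ (-α)) Filter.atTop (nhds 0) := by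
    simpa using ((tendsto_rpow_neg_atTop hα).comp tendsto_natCast_atTop_atTop).const_mul |y|
  -- Once |y| K^(-α) < 1, the K-th approximating series converges absolutely and dominates all later
  -- ones.
  obtain ⟨K, hK0, hK⟩ := ((Filter.eventually_gt_atTop 0).and
    (hlim.eventually (gt_mem_nhds one_pos))).exists
  have hsum : Summable fun n : ℕ => |y| ^ n / Real.GammaSeq (β + α * n) K := by
    have hK' : (0 : ℝ) < K := by exact_mod_cast hK0
    have h := (summable_pow_mul_negBinomCoeff hα.le hβ.le (K + 1) (y := |y| * (K : ℝ) ^ (-α))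
      (by rwa [abs_of_nonneg (by positivity)])).mul_left ((K + 1) * (K : ℝ) ^ (-β))
    exact h.congr fun n => scaled_discreteMittagLeffler_term hα.le hβ hK0 |y| n
  have hs : ∀ n : ℕ, 0 < β + α * n := fun n => by positivity
  have hmain : Filter.Tendsto (fun N : ℕ => ∑' n : ℕ, y ^ n / Real.GammaSeq (β + α * n) N)
      Filter.atTop (nhds (mittagLeffler α β y)) := by
    refine tendsto_tsum_of_dominated_convergence hsum (fun n => ?_) ?_
    · exact Filter.Tendsto.div tendsto_const_nhds (Real.GammaSeq_tendsto_Gamma _)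
        (Real.Gamma_pos_of_pos (hs n)).ne'
    · filter_upwards [Filter.eventually_ge_atTop K] with N hN n
      have h1 := GammaSeq_pos (hs n) hK0
      have h2 := GammaSeq_mono (hs n) hK0 hN
      rw [norm_div, norm_pow, Real.norm_eq_abs, Real.norm_eq_abs, abs_of_pos (h1.trans_le h2)]
      gcongr
  refine hmain.congr' ?_
  filter_upwards [Filter.eventually_gt_atTop 0] with N hN
  rw [discreteMittagLeffler, ← tsum_mul_left]
  exact tsum_congr fun n => (scaled_discreteMittagLeffler_term hα.le hβ hN y n).symm

theorem eventually_mul_rpow_neg_mem_Ioo {α : ℝ} (hα : 0 < α) (y : ℝ) :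
    ∀ᶠ N : ℕ in Filter.atTop, y * (N : ℝ) ^ (-α) ∈ Set.Ioo (-1 : ℝ) 1 := by
  have hlim : Filter.Tendsto (fun N : ℕ => y * (N : ℝ) ^ (-α)) Filter.atTop (nhds 0) := by
    simpa using ((tendsto_rpow_neg_atTop hα).comp tendsto_natCast_atTop_atTop).const_mul y
  exact hlim.eventually (Ioo_mem_nhds (by norm_num) one_pos)

theorem mittagLeffler_nonneg {α β : ℝ} (hα : 0 < α) (hα1 : α ≤ 1) (hβ : α ≤ β) (y : ℝ) :
    0 ≤ mittagLeffler α β y := by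
  refine ge_of_tendsto (tendsto_scaled_discreteMittagLeffler hα (hα.trans_le hβ) y) ?_
  filter_upwards [eventually_mul_rpow_neg_mem_Ioo hα y] with N hN
  exact mul_nonneg (by positivity)
    ((discreteMittagLeffler_convex_mono_nonneg hα.le hα1 hβ (N + 1)).2.2 _ hN)

theorem mittagLeffler_monotone {α β : ℝ} (hα : 0 < α) (hα1 : α ≤ 1) (hβ : α ≤ β) :
    Monotone (mittagLeffler α β) := by
  intro x y hxy
  have ht := tendsto_scaled_discreteMittagLeffler hα (hα.trans_le hβ)
  refine le_of_tendsto_of_tendsto (ht x) (ht y) ?_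
  filter_upwards [eventually_mul_rpow_neg_mem_Ioo hα x, eventually_mul_rpow_neg_mem_Ioo hα y]
    with N hx hy
  refine mul_le_mul_of_nonneg_left ?_ (by positivity)
  exact (discreteMittagLeffler_convex_mono_nonneg hα.le hα1 hβ (N + 1)).2.1 hx hy (by gcongr)

theorem mittagLeffler_convexOn {α β : ℝ} (hα : 0 < α) (hα1 : α ≤ 1) (hβ : α ≤ β) :
    ConvexOn ℝ Set.univ (mittagLeffler α β) := by
  refine ⟨convex_univ, fun x _ y _ a b ha hb hab => ?_⟩
  have ht := tendsto_scaled_discreteMittagLeffler hα (hα.trans_le hβ)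
  refine le_of_tendsto_of_tendsto (ht _) (((ht x).const_mul a).add ((ht y).const_mul b)) ?_
  filter_upwards [eventually_mul_rpow_neg_mem_Ioo hα x, eventually_mul_rpow_neg_mem_Ioo hα y]
    with N hx hy
  have h := (discreteMittagLeffler_convex_mono_nonneg hα.le hα1 hβ (N + 1)).1.2 hx hy ha hb hab
  have hc : (0 : ℝ) ≤ (N + 1) * (N : ℝ) ^ (-β) := by positivity
  have h' := mul_le_mul_of_nonneg_left h hc
  simp only [smul_eq_mul] at h' ⊢
  rw [show (a * x + b * y) * (N : ℝ) ^ (-α)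
    = a * (x * (N : ℝ) ^ (-α)) + b * (y * (N : ℝ) ^ (-α)) by ring]
  linarith

/-! ### Analyticity, strict convexity and a Lipschitz bound. -/

theorem mittagLeffler_hasFPowerSeriesOnBall {α : ℝ} (hα : 0 < α) (β : ℝ) :
    HasFPowerSeriesOnBall (mittagLeffler α β)
      (FormalMultilinearSeries.ofScalars ℝ fun n : ℕ => (Real.Gamma (β + α * n))⁻¹) 0 ⊤ := by
  set p := FormalMultilinearSeries.ofScalars ℝ fun n : ℕ => (Real.Gamma (β + α * n))⁻¹ with hp
  have hr : p.radius = ⊤ := by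
    refine p.radius_eq_top_of_summable_norm fun r => ?_
    refine (summable_mittagLeffler hα β r).norm.congr fun n => ?_
    rw [hp, FormalMultilinearSeries.ofScalars_norm, norm_div, norm_inv, norm_pow,
      NNReal.norm_eq, div_eq_inv_mul]
  have h := p.hasFPowerSeriesOnBall (by rw [hr]; exact ENNReal.zero_lt_top)
  rw [hr] at h
  refine h.congr fun y _ => ?_
  have := congrFun (FormalMultilinearSeries.ofScalarsSum_eq_tsum (E := ℝ)
    (c := fun n : ℕ => (Real.Gamma (β + α * n))⁻¹)) y
  refine this.trans (tsum_congr fun n => ?_)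
  rw [smul_eq_mul, div_eq_inv_mul]

theorem analyticOnNhd_mittagLeffler {α : ℝ} (hα : 0 < α) (β : ℝ) :
    AnalyticOnNhd ℝ (mittagLeffler α β) Set.univ := by
  have h := (mittagLeffler_hasFPowerSeriesOnBall hα β).analyticOnNhd
  simpa [Metric.eball_top] using h

theorem differentiable_mittagLeffler {α : ℝ} (hα : 0 < α) (β : ℝ) :
    Differentiable ℝ (mittagLeffler α β) :=
  fun x => (analyticOnNhd_mittagLeffler hα β x (Set.mem_univ x)).differentiableAt

theorem mittagLeffler_zero (α β : ℝ) : mittagLeffler α β 0 = 1 / Real.Gamma β := by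
  rw [mittagLeffler, tsum_eq_single 0 fun n hn => by simp [hn]]
  simp

theorem deriv_mittagLeffler_zero {α : ℝ} (hα : 0 < α) (β : ℝ) :
    deriv (mittagLeffler α β) 0 = 1 / Real.Gamma (β + α) := by
  rw [(mittagLeffler_hasFPowerSeriesOnBall hα β).hasFPowerSeriesAt.hasDerivAt.deriv,
    FormalMultilinearSeries.ofScalars_apply_eq]
  simp

/-- If the increasing derivative repeated a value, it would be constant on an interval, hence
everywhere by analyticity. An affine function cannot dominate the positive quadratic Taylor term on
the positive axis. -/
theorem mittagLeffler_strictConvexOn {α β : ℝ} (hα : 0 < α) (hα1 : α ≤ 1) (hβ : α ≤ β) :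
    StrictConvexOn ℝ Set.univ (mittagLeffler α β) := by
  have hd := differentiable_mittagLeffler hα β
  have hmono : Monotone (deriv (mittagLeffler α β)) := by
    rw [← monotoneOn_univ]
    exact (mittagLeffler_convexOn hα hα1 hβ).monotoneOn_deriv fun x _ => hd x
  refine StrictMono.strictConvexOn_univ_of_deriv hd.continuous
    (hmono.strictMono_of_injective fun a b hab => ?_)
  by_contra hne
  wlog hlt : a < b generalizing a b
  · exact this b a hab.symm (Ne.symm hne) (lt_of_le_of_ne (not_lt.mp hlt) (Ne.symm hne))
  obtain ⟨c, hac, hcb⟩ := exists_between hlt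
  have hconst : deriv (mittagLeffler α β) = fun _ => deriv (mittagLeffler α β) a := by
    refine AnalyticOnNhd.eq_of_eventuallyEq (analyticOnNhd_mittagLeffler hα β).deriv
      analyticOnNhd_const (z₀ := c) ?_
    filter_upwards [Ioo_mem_nhds hac hcb] with z hz
    exact le_antisymm ((hmono hz.2.le).trans_eq hab.symm) (hmono hz.1.le)
  set k := deriv (mittagLeffler α β) a with hk
  have haff : ∀ y, mittagLeffler α β y = mittagLeffler α β 0 + k * y := by
    intro y
    have h := is_const_of_deriv_eq_zero (f := fun y => mittagLeffler α β y - k * y)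
      (hd.sub (differentiable_id.const_mul k)) (fun x => by
        have h1 : HasDerivAt (fun y => mittagLeffler α β y - k * y) (k - k * 1) x := by
          have := (hd x).hasDerivAt
          rw [hconst] at this
          exact this.sub ((hasDerivAt_id x).const_mul k)
        rw [h1.deriv]; ring) y 0
    linarith
  have hβ0 : 0 < β := hα.trans_le hβ
  have hG : ∀ n : ℕ, 0 < Real.Gamma (β + α * n) := fun n => Real.Gamma_pos_of_pos (by positivity)
  have hlow : ∀ y : ℝ, 0 ≤ y → 1 / Real.Gamma β + y / Real.Gamma (β + α)
      + y ^ 2 / Real.Gamma (β + α * 2) ≤ mittagLeffler α β y := by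
    intro y hy
    have h := (summable_mittagLeffler hα β y).sum_le_tsum (Finset.range 3)
      fun n _ => div_nonneg (pow_nonneg hy n) (hG n).le
    simpa [Finset.sum_range_succ, mittagLeffler] using h
  have hG1 := hG 1
  have hG2 := hG 2
  push_cast at hG1 hG2
  rw [mul_one] at hG1
  set g := Real.Gamma (β + α * 2)
  -- At y = g(|k| + 1) the quadratic term y²/g equals (|k| + 1) y, which exceeds k y.
  have h1 := hlow (g * (|k| + 1)) (by positivity)
  rw [haff, mittagLeffler_zero] at h1
  have h2 : 0 ≤ g * (|k| + 1) / Real.Gamma (β + α) := by positivity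
  have h3 : (g * (|k| + 1)) ^ 2 / g = (|k| + 1) * (g * (|k| + 1)) := by field_simp
  have h4 : k * (g * (|k| + 1)) < (|k| + 1) * (g * (|k| + 1)) := by
    have := le_abs_self k
    exact mul_lt_mul_of_pos_right (by linarith) (by positivity)
  linarith

/-- By convexity, the derivative on the negative axis is at most its value at 0. -/
theorem abs_mittagLeffler_sub_le {α β : ℝ} (hα : 0 < α) (hα1 : α ≤ 1) (hβ : α ≤ β) {x y : ℝ}
    (hx : x ≤ 0) (hy : y ≤ 0) :
    |mittagLeffler α β x - mittagLeffler α β y| ≤ |x - y| / Real.Gamma (β + α) := by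
  wlog hyx : y ≤ x generalizing x y
  · rw [abs_sub_comm, abs_sub_comm x]
    exact this hy hx (le_of_not_ge hyx)
  have hd := differentiable_mittagLeffler hα β
  have hmono : MonotoneOn (deriv (mittagLeffler α β)) Set.univ :=
    (mittagLeffler_convexOn hα hα1 hβ).monotoneOn_deriv fun x _ => hd x
  rw [abs_of_nonneg (sub_nonneg.mpr (mittagLeffler_monotone hα hα1 hβ hyx)),
    abs_of_nonneg (sub_nonneg.mpr hyx)]
  have h := (convex_Iic (0 : ℝ)).image_sub_le_mul_sub_of_deriv_le (C := 1 / Real.Gamma (β + α))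
    hd.continuous.continuousOn hd.differentiableOn (fun z hz => by
      rw [← deriv_mittagLeffler_zero hα β]
      rw [interior_Iic] at hz
      exact hmono (Set.mem_univ _) (Set.mem_univ _) (Set.mem_Iio.mp hz).le) y hy x hx hyx
  exact h.trans_eq (by ring)

/-! ### Beta averaging and monotonicity in β. -/

open MeasureTheory ProbabilityTheory in
theorem integral_betaPDFReal {a b : ℝ} (ha : 0 < a) (hb : 0 < b) :
    ∫ x, betaPDFReal a b x = 1 := by
  rw [integral_eq_lintegral_of_nonneg_ae _ (measurable_betaPDFReal a b).aestronglyMeasurable]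
  · exact (congrArg ENNReal.toReal (lintegral_betaPDF_eq_one ha hb)).trans ENNReal.toReal_one
  · refine Filter.Eventually.of_forall fun x => ?_
    by_cases h : 0 < x ∧ x < 1
    · exact (betaPDFReal_pos h.1 h.2 ha hb).le
    · simp [betaPDFReal, h]

open MeasureTheory ProbabilityTheory in
theorem ae_betaMeasure_mem_Ioo (a b : ℝ) : ∀ᵐ x ∂betaMeasure a b, x ∈ Set.Ioo (0 : ℝ) 1 := by
  have hm : Measurable (betaPDF a b) := (measurable_betaPDFReal a b).ennreal_ofReal
  rw [betaMeasure, ae_withDensity_iff hm]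
  refine Filter.Eventually.of_forall fun x hx => ?_
  by_contra h
  exact hx (by simp [betaPDF_eq, show ¬ (0 < x ∧ x < 1) from h])

open MeasureTheory ProbabilityTheory in
theorem betaPDFReal_mul_rpow {a b : ℝ} (ha : 0 < a) (hb : 0 < b) {c : ℝ} (hc : 0 ≤ c) (x : ℝ) :
    betaPDFReal a b x * x ^ c = beta (a + c) b / beta a b * betaPDFReal (a + c) b x := by
  have h1 := (beta_pos ha hb).ne'
  have h2 := (beta_pos (by positivity : 0 < a + c) hb).ne'
  by_cases h : 0 < x ∧ x < 1
  · rw [betaPDFReal, betaPDFReal, if_pos h, if_pos h, show a + c - 1 = a - 1 + c by ring,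
      Real.rpow_add h.1]
    field_simp
  · simp [betaPDFReal, h]

open MeasureTheory ProbabilityTheory in
theorem integrable_rpow_betaMeasure {a b : ℝ} (ha : 0 < a) (hb : 0 < b) {c : ℝ} (hc : 0 ≤ c) :
    Integrable (fun x : ℝ => x ^ c) (betaMeasure a b) := by
  have := isProbabilityMeasureBeta ha hb
  refine Integrable.of_bound (by fun_prop) 1 ?_
  filter_upwards [ae_betaMeasure_mem_Ioo a b] with x hx
  rw [Real.norm_eq_abs, abs_of_nonneg (Real.rpow_nonneg hx.1.le c)]
  exact Real.rpow_le_one hx.1.le hx.2.le hc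

open MeasureTheory ProbabilityTheory in
theorem integral_rpow_betaMeasure {a b : ℝ} (ha : 0 < a) (hb : 0 < b) {c : ℝ} (hc : 0 ≤ c) :
    ∫ x, x ^ c ∂betaMeasure a b = beta (a + c) b / beta a b := by
  have hm : Measurable (betaPDF a b) := (measurable_betaPDFReal a b).ennreal_ofReal
  rw [betaMeasure, integral_withDensity_eq_integral_toReal_smul hm
    (Filter.Eventually.of_forall fun x => ENNReal.ofReal_lt_top)]
  have : ∀ x, (betaPDF a b x).toReal • x ^ c
      = beta (a + c) b / beta a b * betaPDFReal (a + c) b x := by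
    intro x
    rw [← betaPDFReal_mul_rpow ha hb hc, smul_eq_mul, betaPDF, ENNReal.toReal_ofReal]
    by_cases h : 0 < x ∧ x < 1
    · exact (betaPDFReal_pos h.1 h.2 ha hb).le
    · simp [betaPDFReal, h]
  simp_rw [this]
  rw [integral_const_mul, integral_betaPDFReal (by positivity) hb, mul_one]

open MeasureTheory ProbabilityTheory in
/-- Multiplying the Mittag-Leffler law of parameter `β` by an independent power of a Beta variable
gives the law of parameter `γ`. -/
theorem integral_mittagLeffler_betaMeasure {α β γ : ℝ} (hα : 0 < α) (hβ : 0 < β) (hγ : β < γ)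
    (y : ℝ) :
    ∫ b, Real.Gamma β * mittagLeffler α β (y * b ^ α) ∂betaMeasure β (γ - β)
      = Real.Gamma γ * mittagLeffler α γ y := by
  have hγ0 : 0 < γ := hβ.trans hγ
  have hδ : 0 < γ - β := sub_pos.mpr hγ
  have hGβ := Real.Gamma_pos_of_pos hβ
  have hGγ := Real.Gamma_pos_of_pos hγ0
  have hGδ := Real.Gamma_pos_of_pos hδ
  have hB : ∀ n : ℕ, 0 < Real.Gamma (β + α * n) := fun n => Real.Gamma_pos_of_pos (by positivity)
  have hC : ∀ n : ℕ, 0 < Real.Gamma (γ + α * n) := fun n => Real.Gamma_pos_of_pos (by positivity)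
  have hmom : ∀ n : ℕ, ∀ z : ℝ, Real.Gamma β * (z ^ n / Real.Gamma (β + α * n)) *
      (beta (β + α * n) (γ - β) / beta β (γ - β))
      = Real.Gamma γ * (z ^ n / Real.Gamma (γ + α * n)) := by
    intro n z
    rw [beta, beta, show β + α * n + (γ - β) = γ + α * n by ring,
      show β + (γ - β) = γ by ring]
    have := (hB n).ne'
    have := (hC n).ne'
    field_simp
  have hnorm : ∀ n : ℕ, ∫ b, ‖Real.Gamma β * (y ^ n / Real.Gamma (β + α * n)) * b ^ (α * n)‖
      ∂betaMeasure β (γ - β) = Real.Gamma γ * (|y| ^ n / Real.Gamma (γ + α * n)) := by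
    intro n
    rw [← hmom, ← integral_rpow_betaMeasure hβ hδ (by positivity), ← integral_const_mul]
    refine integral_congr_ae ?_
    filter_upwards [ae_betaMeasure_mem_Ioo β (γ - β)] with b hb
    rw [norm_mul, norm_mul, norm_div, norm_pow, Real.norm_eq_abs, Real.norm_eq_abs,
      Real.norm_eq_abs, Real.norm_eq_abs, abs_of_pos hGβ, abs_of_pos (hB n),
      abs_of_nonneg (Real.rpow_nonneg hb.1.le _)]
  have hint := hasSum_integral_of_summable_integral_norm
    (μ := betaMeasure β (γ - β))
    (F := fun (n : ℕ) (b : ℝ) => Real.Gamma β * (y ^ n / Real.Gamma (β + α * n)) * b ^ (α * n))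
    (fun n => (integrable_rpow_betaMeasure hβ hδ (by positivity)).const_mul _)
    (((summable_mittagLeffler hα γ |y|).mul_left (Real.Gamma γ)).congr fun n => (hnorm n).symm)
  have h1 : ∀ n : ℕ, ∫ b, Real.Gamma β * (y ^ n / Real.Gamma (β + α * n)) * b ^ (α * n)
      ∂betaMeasure β (γ - β) = Real.Gamma γ * (y ^ n / Real.Gamma (γ + α * n)) := by
    intro n
    rw [integral_const_mul, integral_rpow_betaMeasure hβ hδ (by positivity), hmom]
  simp_rw [h1] at hint
  have h2 := hint.unique ((summable_mittagLeffler hα γ y).hasSum.mul_left (Real.Gamma γ))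
  rw [mittagLeffler, ← h2]
  refine integral_congr_ae ?_
  filter_upwards [ae_betaMeasure_mem_Ioo β (γ - β)] with b hb
  rw [mittagLeffler, ← tsum_mul_left]
  refine tsum_congr fun n => ?_
  rw [mul_pow, ← Real.rpow_natCast (b ^ α), ← Real.rpow_mul hb.1.le]
  ring

open MeasureTheory ProbabilityTheory in
theorem strictMonoOn_normalized_mittagLeffler {α x : ℝ} (hα : 0 < α) (hα1 : α ≤ 1)
    (hx : x ≠ 0) :
    StrictMonoOn (fun β : ℝ =>
      Real.Gamma β * mittagLeffler α β (Real.Gamma (β + α) / Real.Gamma β * x)) (Set.Ioi α) := by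
  intro β hβ γ hγ hlt
  have hβα : α < β := hβ
  have hβ0 : 0 < β := hα.trans hβα
  have hγ0 : 0 < γ := hβ0.trans hlt
  have hδ : 0 < γ - β := sub_pos.mpr hlt
  have hGβ := Real.Gamma_pos_of_pos hβ0
  have hGγ := Real.Gamma_pos_of_pos hγ0
  have hGδ := Real.Gamma_pos_of_pos hδ
  have hGβ' := Real.Gamma_pos_of_pos (by positivity : 0 < β + α)
  have hGγ' := Real.Gamma_pos_of_pos (by positivity : 0 < γ + α)
  have := isProbabilityMeasureBeta hβ0 hδ
  set μ := betaMeasure β (γ - β) with hμ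
  set y := Real.Gamma (γ + α) / Real.Gamma γ * x with hy
  have hy0 : y ≠ 0 := mul_ne_zero (by positivity) hx
  have hcont : Continuous (mittagLeffler α β) := (differentiable_mittagLeffler hα β).continuous
  have hsc : StrictConvexOn ℝ Set.univ fun z => Real.Gamma β * mittagLeffler α β z :=
    ⟨convex_univ, fun u hu v hv huv a b ha hb hab => by
      have h := mul_lt_mul_of_pos_left
        ((mittagLeffler_strictConvexOn hα hα1 hβα.le).2 hu hv huv ha hb hab) hGβ
      simp only [smul_eq_mul] at h ⊢
      linarith⟩
  have hmean : ∫ b, y * b ^ α ∂μ = Real.Gamma (β + α) / Real.Gamma β * x := by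
    rw [integral_const_mul, integral_rpow_betaMeasure hβ0 hδ hα.le, beta, beta,
      show β + α + (γ - β) = γ + α by ring, show β + (γ - β) = γ by ring, hy]
    field_simp
  have hmeas : Measurable fun b : ℝ => y * b ^ α := by fun_prop
  have hbd : ∃ C, ∀ z, |z| ≤ |y| → ‖Real.Gamma β * mittagLeffler α β z‖ ≤ C := by
    obtain ⟨C, hC⟩ := (isCompact_Icc (a := -|y|) (b := |y|)).exists_bound_of_continuousOn
      (f := fun z => Real.Gamma β * mittagLeffler α β z) (by fun_prop)
    exact ⟨C, fun z hz => hC z (abs_le.mp hz)⟩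
  obtain ⟨C, hC⟩ := hbd
  have hJ := hsc.ae_eq_const_or_map_average_lt (μ := μ) (f := fun b : ℝ => y * b ^ α)
    (by fun_prop) isClosed_univ (Filter.Eventually.of_forall fun _ => Set.mem_univ _)
    ((integrable_rpow_betaMeasure hβ0 hδ hα.le).const_mul y)
    (by
      refine Integrable.of_bound (C := C) ?_ ?_
      · exact ((by fun_prop : Continuous fun z =>
          Real.Gamma β * mittagLeffler α β z).measurable.comp hmeas).aestronglyMeasurable
      · filter_upwards [ae_betaMeasure_mem_Ioo β (γ - β)] with b hb
        refine hC _ ?_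
        rw [abs_mul, abs_of_nonneg (Real.rpow_nonneg hb.1.le α)]
        exact mul_le_of_le_one_right (abs_nonneg y) (Real.rpow_le_one hb.1.le hb.2.le hα.le))
  rw [average_eq_integral, average_eq_integral, hmean,
    integral_mittagLeffler_betaMeasure hα hβ0 hlt] at hJ
  refine hJ.resolve_left fun hconst => ?_
  -- Equality in Jensen would force b^α, hence b, to be almost surely constant, but a Beta law has
  -- no atoms.
  have hsub : ∀ᵐ b ∂μ, b = ((Real.Gamma (β + α) / Real.Gamma β * x) / y) ^ α⁻¹ := by
    filter_upwards [hconst, ae_betaMeasure_mem_Ioo β (γ - β)] with b h hb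
    rw [Function.const_apply] at h
    rw [← h, mul_div_cancel_left₀ _ hy0, ← Real.rpow_mul hb.1.le, mul_inv_cancel₀ hα.ne',
      Real.rpow_one]
  set p := ((Real.Gamma (β + α) / Real.Gamma β * x) / y) ^ α⁻¹
  have hac : μ ≪ volume := withDensity_absolutelyContinuous _ _
  have h0 : μ {p} = 0 := hac (measure_singleton p)
  have h1 : ∀ᵐ b ∂μ, b ≠ p := by
    rw [ae_iff]
    simpa using h0
  obtain ⟨b, hb1, hb2⟩ := (hsub.and h1).exists
  exact hb2 hb1

/-! ### Gamma ratios and normalized Taylor coefficients. -/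

/-- The ratio `Γ(b + a) / Γ(b)`. -/
noncomputable def gammaRatio (a b : ℝ) : ℝ := Real.Gamma (b + a) / Real.Gamma b

theorem gammaRatio_pos {a b : ℝ} (ha : 0 ≤ a) (hb : 0 < b) : 0 < gammaRatio a b :=
  div_pos (Real.Gamma_pos_of_pos (by positivity)) (Real.Gamma_pos_of_pos hb)

/-- Log-convexity of Γ: b + a and c are convex combinations of b and c + a with swapped weights, so
Γ(b+a)Γ(c) ≤ Γ(b)Γ(c+a). -/
theorem gammaRatio_le {a b c : ℝ} (ha : 0 ≤ a) (hb : 0 < b) (hbc : b ≤ c) :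
    gammaRatio a b ≤ gammaRatio a c := by
  have hc : 0 < c := hb.trans_le hbc
  rcases ha.eq_or_lt with rfl | ha'
  · simp [gammaRatio, (Real.Gamma_pos_of_pos hb).ne', (Real.Gamma_pos_of_pos hc).ne']
  rcases hbc.eq_or_lt with rfl | hlt
  · exact le_rfl
  have hd : 0 < c + a - b := by linarith
  have hs := Real.Gamma_pos_of_pos hb
  have ht := Real.Gamma_pos_of_pos (by positivity : 0 < c + a)
  have hsum : a / (c + a - b) + (c - b) / (c + a - b) = 1 := by field_simp; ring
  have hθ : 0 < a / (c + a - b) := by positivity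
  have hη : 0 < (c - b) / (c + a - b) := div_pos (by linarith) hd
  have h1 := Real.Gamma_mul_add_mul_le_rpow_Gamma_mul_rpow_Gamma hb
    (by positivity : 0 < c + a) hη hθ (by rw [add_comm]; exact hsum)
  have h2 := Real.Gamma_mul_add_mul_le_rpow_Gamma_mul_rpow_Gamma hb
    (by positivity : 0 < c + a) hθ hη hsum
  rw [show (c - b) / (c + a - b) * b + a / (c + a - b) * (c + a) = b + a by
    field_simp; ring] at h1
  rw [show a / (c + a - b) * b + (c - b) / (c + a - b) * (c + a) = c by
    field_simp; ring] at h2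
  rw [gammaRatio, gammaRatio, div_le_div_iff₀ hs (Real.Gamma_pos_of_pos hc)]
  refine (mul_le_mul h1 h2 (Real.Gamma_pos_of_pos hc).le (by positivity)).trans_eq ?_
  rw [mul_mul_mul_comm, ← Real.rpow_add hs, ← Real.rpow_add ht, hsum, add_comm, hsum,
    Real.rpow_one, Real.rpow_one, mul_comm]

theorem gammaRatio_add_one {a b : ℝ} (ha : 0 ≤ a) (hb : 0 < b) :
    gammaRatio a (b + 1) = gammaRatio a b * ((b + a) / b) := by
  rw [gammaRatio, gammaRatio, show b + 1 + a = b + a + 1 by ring,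
    Real.Gamma_add_one (by positivity), Real.Gamma_add_one hb.ne']
  have := (Real.Gamma_pos_of_pos hb).ne'
  field_simp

theorem tendsto_gammaRatio_add_natCast_div {a : ℝ} (ha : 0 ≤ a) (m : ℕ) :
    Filter.Tendsto (fun b => gammaRatio a (b + m) / gammaRatio a b) Filter.atTop (nhds 1) := by
  induction m with
  | zero =>
    refine tendsto_const_nhds.congr' ?_
    filter_upwards [Filter.eventually_gt_atTop 0] with b hb
    simp [(gammaRatio_pos ha hb).ne']
  | succ m ih =>
    have h : Filter.Tendsto (fun b : ℝ => 1 + a * (b + m)⁻¹) Filter.atTop (nhds 1) := by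
      have := (tendsto_inv_atTop_zero.comp
        (Filter.tendsto_atTop_add_const_right Filter.atTop (m : ℝ) Filter.tendsto_id)).const_mul a
      simpa using this.const_add 1
    have h' := ih.mul h
    rw [one_mul] at h'
    refine h'.congr' ?_
    filter_upwards [Filter.eventually_gt_atTop 0] with b hb
    push_cast
    rw [← add_assoc, gammaRatio_add_one ha (by positivity)]
    have : b + m ≠ 0 := by positivity
    field_simp

/-- Monotonicity squeezes the quotient between 1 and its value at an integer shift, where the
functional equation applies. -/
theorem tendsto_gammaRatio_add_div {a δ : ℝ} (ha : 0 ≤ a) (hδ : 0 ≤ δ) :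
    Filter.Tendsto (fun b => gammaRatio a (b + δ) / gammaRatio a b) Filter.atTop (nhds 1) := by
  obtain ⟨m, hm⟩ := exists_nat_ge δ
  refine tendsto_of_tendsto_of_tendsto_of_le_of_le' tendsto_const_nhds
    (tendsto_gammaRatio_add_natCast_div ha m) ?_ ?_
  · filter_upwards [Filter.eventually_gt_atTop 0] with b hb
    rw [le_div_iff₀ (gammaRatio_pos ha hb), one_mul]
    exact gammaRatio_le ha hb (by linarith)
  · filter_upwards [Filter.eventually_gt_atTop 0] with b hb
    have := (gammaRatio_pos ha hb).le
    gcongr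
    exact gammaRatio_le ha (by positivity) (by linarith)

/-- The coefficients of the power series of the normalized Mittag-Leffler function. -/
noncomputable def normalizedCoeff (α β : ℝ) (n : ℕ) : ℝ :=
  Real.Gamma β * gammaRatio α β ^ n / Real.Gamma (β + α * n)

theorem normalizedCoeff_zero (α : ℝ) {β : ℝ} (hβ : 0 < β) : normalizedCoeff α β 0 = 1 := by
  simp [normalizedCoeff, (Real.Gamma_pos_of_pos hβ).ne']

theorem normalizedCoeff_succ {α β : ℝ} (hα : 0 ≤ α) (hβ : 0 < β) (n : ℕ) :
    normalizedCoeff α β (n + 1)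
      = normalizedCoeff α β n * (gammaRatio α (β + α * n) / gammaRatio α β)⁻¹ := by
  have h1 : Real.Gamma (β + α * (n + 1 : ℕ))
      = Real.Gamma (β + α * n) * gammaRatio α (β + α * n) := by
    rw [gammaRatio, mul_div_cancel₀ _ (Real.Gamma_pos_of_pos (by positivity)).ne']
    push_cast
    ring_nf
  have := (gammaRatio_pos hα (by positivity : 0 < β + α * n)).ne'
  have := (Real.Gamma_pos_of_pos (by positivity : 0 < β + α * n)).ne'
  rw [normalizedCoeff, normalizedCoeff, h1]
  field_simp
  ring

theorem normalizedCoeff_pos {α β : ℝ} (hα : 0 ≤ α) (hβ : 0 < β) (n : ℕ) :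
    0 < normalizedCoeff α β n := by
  have := gammaRatio_pos hα hβ
  have := Real.Gamma_pos_of_pos hβ
  have := Real.Gamma_pos_of_pos (by positivity : 0 < β + α * n)
  unfold normalizedCoeff
  positivity

theorem normalizedCoeff_le_one {α β : ℝ} (hα : 0 ≤ α) (hβ : 0 < β) (n : ℕ) :
    normalizedCoeff α β n ≤ 1 := by
  induction n with
  | zero => exact (normalizedCoeff_zero α hβ).le
  | succ n ih =>
    rw [normalizedCoeff_succ hα hβ, inv_div]
    refine mul_le_one₀ ih (div_nonneg (gammaRatio_pos hα hβ).le
      (gammaRatio_pos hα (by positivity)).le) ?_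
    rw [div_le_one (gammaRatio_pos hα (by positivity))]
    exact gammaRatio_le hα hβ (le_add_of_nonneg_right (by positivity))

theorem tendsto_normalizedCoeff {α : ℝ} (hα : 0 ≤ α) (n : ℕ) :
    Filter.Tendsto (fun β => normalizedCoeff α β n) Filter.atTop (nhds 1) := by
  induction n with
  | zero =>
    refine tendsto_const_nhds.congr' ?_
    filter_upwards [Filter.eventually_gt_atTop 0] with β hβ
    exact (normalizedCoeff_zero α hβ).symm
  | succ n ih =>
    have h := ih.mul ((tendsto_gammaRatio_add_div hα
      (by positivity : 0 ≤ α * n)).inv₀ one_ne_zero)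
    rw [inv_one, mul_one] at h
    refine h.congr' ?_
    filter_upwards [Filter.eventually_gt_atTop 0] with β hβ
    exact (normalizedCoeff_succ hα hβ n).symm

/-! ### Limits for x ≥ 1 and for |x| < 1. -/

theorem hasSum_normalized_mittagLeffler {α : ℝ} (hα : 0 < α) (β x : ℝ) :
    HasSum (fun n : ℕ => normalizedCoeff α β n * x ^ n)
      (Real.Gamma β * mittagLeffler α β (Real.Gamma (β + α) / Real.Gamma β * x)) := by
  refine ((summable_mittagLeffler hα β _).hasSum.mul_left (Real.Gamma β)).congr_fun ?_
  intro n
  rw [normalizedCoeff, gammaRatio, mul_pow]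
  ring

theorem tendsto_normalized_mittagLeffler_atTop {α x : ℝ} (hα : 0 < α) (hx : 1 ≤ x) :
    Filter.Tendsto (fun β : ℝ =>
      Real.Gamma β * mittagLeffler α β (Real.Gamma (β + α) / Real.Gamma β * x))
      Filter.atTop Filter.atTop := by
  rw [Filter.tendsto_atTop]
  intro C
  obtain ⟨N, hN⟩ := exists_nat_gt C
  have hlim : Filter.Tendsto (fun β => ∑ n ∈ Finset.range N, normalizedCoeff α β n)
      Filter.atTop (nhds N) := by
    simpa using tendsto_finsetSum (Finset.range N) fun n _ => tendsto_normalizedCoeff hα.le n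
  filter_upwards [hlim.eventually (lt_mem_nhds hN), Filter.eventually_gt_atTop 0] with β h1 hβ
  have hs := hasSum_normalized_mittagLeffler hα β x
  have hc := fun n => (normalizedCoeff_pos hα.le hβ n).le
  have hx0 : 0 ≤ x := zero_le_one.trans hx
  have h2 := sum_le_hasSum (Finset.range N)
    (fun n _ => mul_nonneg (hc n) (pow_nonneg hx0 n)) hs
  refine h1.le.trans (le_trans (Finset.sum_le_sum fun n _ => ?_) h2)
  exact le_mul_of_one_le_right (hc n) (one_le_pow₀ hx)

theorem tendsto_normalized_mittagLeffler_of_abs_lt_one {α x : ℝ} (hα : 0 < α) (hx : |x| < 1) :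
    Filter.Tendsto (fun β : ℝ =>
      Real.Gamma β * mittagLeffler α β (Real.Gamma (β + α) / Real.Gamma β * x))
      Filter.atTop (nhds (1 / (1 - x))) := by
  have h : Filter.Tendsto (fun β => ∑' n : ℕ, normalizedCoeff α β n * x ^ n) Filter.atTop
      (nhds (∑' n : ℕ, x ^ n)) := by
    refine tendsto_tsum_of_dominated_convergence
      (summable_geometric_of_lt_one (abs_nonneg x) hx) (fun n => ?_) ?_
    · simpa using (tendsto_normalizedCoeff hα.le n).mul_const (x ^ n)
    · filter_upwards [Filter.eventually_gt_atTop 0] with β hβ n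
      rw [norm_mul, norm_pow, Real.norm_eq_abs, Real.norm_eq_abs,
        abs_of_pos (normalizedCoeff_pos hα.le hβ n)]
      exact mul_le_of_le_one_left (by positivity) (normalizedCoeff_le_one hα.le hβ n)
  rw [tsum_geometric_of_abs_lt_one hx] at h
  rw [one_div]
  exact h.congr fun β => (hasSum_normalized_mittagLeffler hα β x).tsum_eq

/-! ### The Laplace transform. -/

theorem integrableOn_rpow_mul_exp_neg_mul_Ioi {a r : ℝ} (ha : 0 < a) (hr : 0 < r) :
    MeasureTheory.IntegrableOn (fun t : ℝ => t ^ (a - 1) * Real.exp (-(r * t))) (Set.Ioi 0) := by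
  -- The integral of a non-integrable function is 0 by convention, so a nonzero value proves
  -- integrability.
  refine MeasureTheory.Integrable.of_integral_ne_zero ?_
  rw [Real.integral_rpow_mul_exp_neg_mul_Ioi ha hr]
  have := Real.Gamma_pos_of_pos ha
  positivity

theorem mittagLeffler_le_of_nonpos {α β : ℝ} (hα : 0 < α) (hα1 : α ≤ 1) (hβ : α ≤ β) {y : ℝ}
    (hy : y ≤ 0) : mittagLeffler α β y ≤ 1 / Real.Gamma β :=
  (mittagLeffler_monotone hα hα1 hβ hy).trans_eq (mittagLeffler_zero α β)

theorem integrableOn_rpow_mul_exp_mul_mittagLeffler {α β r : ℝ} (hα : 0 < α) (hα1 : α ≤ 1)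
    (hβ : α ≤ β) (hr : 0 < r) :
    MeasureTheory.IntegrableOn (fun t : ℝ => t ^ (β - 1) * Real.exp (-(r * t)) *
      mittagLeffler α β (-t ^ α)) (Set.Ioi 0) := by
  have hβ0 := hα.trans_le hβ
  refine MeasureTheory.Integrable.mono'
    ((integrableOn_rpow_mul_exp_neg_mul_Ioi hβ0 hr).mul_const (1 / Real.Gamma β)) ?_ ?_
  · have hm : Measurable (mittagLeffler α β) :=
      (differentiable_mittagLeffler hα β).continuous.measurable
    exact Measurable.aestronglyMeasurable (by fun_prop)
  · filter_upwards [MeasureTheory.ae_restrict_mem measurableSet_Ioi] with t ht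
    have ht0 : (0 : ℝ) < t := ht
    rw [Real.norm_eq_abs, abs_of_nonneg
      (mul_nonneg (by positivity) (mittagLeffler_nonneg hα hα1 hβ _))]
    exact mul_le_mul_of_nonneg_left (mittagLeffler_le_of_nonpos hα hα1 hβ
      (neg_nonpos.mpr (by positivity))) (by positivity)

-- Termwise integration; r > 1 is needed for the resulting geometric series in r^(-α) to converge
-- absolutely.
open MeasureTheory in
theorem laplace_mittagLeffler_of_one_lt {α β r : ℝ} (hα : 0 < α) (hβ : 0 < β) (hr : 1 < r) :
    ∫ t in Set.Ioi (0 : ℝ), t ^ (β - 1) * Real.exp (-(r * t)) * mittagLeffler α β (-t ^ α)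
      = r ^ (-β) / (1 + r ^ (-α)) := by
  have hr0 : 0 < r := zero_lt_one.trans hr
  have hG : ∀ n : ℕ, 0 < Real.Gamma (β + α * n) := fun n => Real.Gamma_pos_of_pos (by positivity)
  have hmom : ∀ n : ℕ, ∫ t in Set.Ioi (0 : ℝ), 1 / Real.Gamma (β + α * n) *
      (t ^ (β + α * n - 1) * Real.exp (-(r * t))) = r ^ (-β) * (r ^ (-α)) ^ n := by
    intro n
    rw [integral_const_mul, Real.integral_rpow_mul_exp_neg_mul_Ioi (by positivity) hr0,
      one_div r, Real.inv_rpow hr0.le, ← Real.rpow_neg hr0.le, ← Real.rpow_natCast,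
      ← Real.rpow_mul hr0.le, ← Real.rpow_add hr0, show -β + -α * n = -(β + α * n) by ring]
    have := (hG n).ne'
    field_simp
  have hq : r ^ (-α) < 1 := Real.rpow_lt_one_of_one_lt_of_neg hr (by linarith)
  have hq0 : 0 < r ^ (-α) := by positivity
  have hint := hasSum_integral_of_summable_integral_norm (μ := volume.restrict (Set.Ioi (0 : ℝ)))
    (F := fun (n : ℕ) (t : ℝ) => (-1) ^ n * (1 / Real.Gamma (β + α * n) *
      (t ^ (β + α * n - 1) * Real.exp (-(r * t)))))
    (fun n => ((integrableOn_rpow_mul_exp_neg_mul_Ioi (by positivity) hr0).const_mul _).const_mul _)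
    (by
      refine ((summable_geometric_of_lt_one hq0.le hq).mul_left (r ^ (-β))).congr fun n => ?_
      rw [← hmom]
      refine setIntegral_congr_fun measurableSet_Ioi fun t ht => ?_
      have ht0 : (0 : ℝ) < t := ht
      have := hG n
      simp only [norm_mul, norm_pow, norm_neg, norm_one, one_pow, one_mul]
      rw [← norm_mul, ← norm_mul, Real.norm_eq_abs, abs_of_pos (by positivity)])
  have hrhs : HasSum (fun n : ℕ => (-1) ^ n * (r ^ (-β) * (r ^ (-α)) ^ n))
      (r ^ (-β) / (1 + r ^ (-α))) := by
    have h := (hasSum_geometric_of_abs_lt_one (r := -r ^ (-α))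
      (by rwa [abs_neg, abs_of_pos hq0])).mul_left (r ^ (-β))
    rw [sub_neg_eq_add, ← div_eq_mul_inv] at h
    refine h.congr_fun fun n => ?_
    rw [neg_pow (r ^ (-α))]
    ring
  simp_rw [integral_const_mul ((-1 : ℝ) ^ _), hmom] at hint
  rw [← hint.unique hrhs]
  refine setIntegral_congr_fun measurableSet_Ioi fun t ht => ?_
  have ht0 : (0 : ℝ) < t := ht
  simp only [mittagLeffler]
  rw [← tsum_mul_left]
  refine tsum_congr fun n => ?_
  rw [neg_pow, ← Real.rpow_natCast (t ^ α), ← Real.rpow_mul ht0.le,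
    show β + α * n - 1 = β - 1 + α * n by ring, Real.rpow_add ht0]
  ring

-- Analytic continuation from r > 1. Nonnegativity of the Mittag-Leffler function makes the
-- integrand, without its exponential, the density of a measure; the transform is then a moment
-- generating function at s = -r, analytic for s < 0.
open MeasureTheory ProbabilityTheory in
theorem laplace_mittagLeffler {α β r : ℝ} (hα : 0 < α) (hα1 : α ≤ 1) (hβ : α ≤ β) (hr : 0 < r) :
    ∫ t in Set.Ioi (0 : ℝ), t ^ (β - 1) * Real.exp (-(r * t)) * mittagLeffler α β (-t ^ α)
      = r ^ (-β) / (1 + r ^ (-α)) := by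
  have hβ0 := hα.trans_le hβ
  have hm : Measurable (mittagLeffler α β) :=
    (differentiable_mittagLeffler hα β).continuous.measurable
  set d : ℝ → ENNReal := fun t => ENNReal.ofReal (t ^ (β - 1) * mittagLeffler α β (-t ^ α))
  have hd : Measurable d := by fun_prop
  have hd_lt : ∀ᵐ t ∂volume.restrict (Set.Ioi (0 : ℝ)), d t < ⊤ :=
    Filter.Eventually.of_forall fun t => ENNReal.ofReal_lt_top
  set ν := (volume.restrict (Set.Ioi (0 : ℝ))).withDensity d with hν
  have hcongr : ∀ s : ℝ, Set.EqOn (fun t : ℝ => (d t).toReal • Real.exp (s * id t))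
      (fun t => t ^ (β - 1) * Real.exp (-(-s * t)) * mittagLeffler α β (-t ^ α))
      (Set.Ioi 0) := by
    intro s t ht
    have ht0 : (0 : ℝ) < t := ht
    simp only [d, smul_eq_mul, id]
    rw [ENNReal.toReal_ofReal (mul_nonneg (by positivity) (mittagLeffler_nonneg hα hα1 hβ _)),
      neg_mul, neg_neg]
    ring
  have hmgf : ∀ s : ℝ, mgf id ν s = ∫ t in Set.Ioi (0 : ℝ),
      t ^ (β - 1) * Real.exp (-(-s * t)) * mittagLeffler α β (-t ^ α) := by
    intro s
    rw [mgf, hν, integral_withDensity_eq_integral_toReal_smul hd hd_lt]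
    exact setIntegral_congr_fun measurableSet_Ioi (hcongr s)
  have hset : Set.Iio (0 : ℝ) ⊆ interior (integrableExpSet id ν) := by
    refine interior_maximal (fun s hs => ?_) isOpen_Iio
    have hs0 : s < 0 := hs
    rw [integrableExpSet, Set.mem_ofPred_eq, hν, integrable_withDensity_iff_integrable_smul' hd hd_lt]
    exact (integrableOn_congr_fun (hcongr s) measurableSet_Ioi).mpr
      (integrableOn_rpow_mul_exp_mul_mittagLeffler hα hα1 hβ (neg_pos.mpr hs0))
  have hR : AnalyticOnNhd ℝ (fun s : ℝ => Real.exp (Real.log (-s) * -β) /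
      (1 + Real.exp (Real.log (-s) * -α))) (Set.Iio 0) := by
    intro s hs
    have hs0 : 0 < -s := neg_pos.mpr hs
    have hlog : AnalyticAt ℝ (fun s : ℝ => Real.log (-s)) s := analyticAt_id.neg.log hs0
    exact (hlog.mul analyticAt_const).rexp.div
      (analyticAt_const.add (hlog.mul analyticAt_const).rexp) (by positivity)
  have heq := (analyticOnNhd_mgf.mono hset).eqOn_of_preconnected_of_eventuallyEq hR
    (convex_Iio (0 : ℝ)).isPreconnected (z₀ := -2) (by norm_num) (by
      filter_upwards [Iio_mem_nhds (show (-2 : ℝ) < -1 by norm_num)] with s hs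
      have hs1 : 1 < -s := by linarith [Set.mem_Iio.mp hs]
      rw [hmgf, laplace_mittagLeffler_of_one_lt hα hβ0 hs1,
        Real.rpow_def_of_pos (by linarith), Real.rpow_def_of_pos (by linarith)])
    (neg_lt_zero.mpr hr)
  simp only [hmgf, neg_neg] at heq
  rw [heq, Real.rpow_def_of_pos hr, Real.rpow_def_of_pos hr]

/-! ### Concentration and the limit for x < 0. -/

-- Let T be Gamma with shape β and rate r, where r^(-α) = l. Then Γ(β)E(α,β;-T^α) has mean 1/(1+l)
-- and T^α has mean m l. The Lipschitz bound reduces the error to the mean of |T^α/m - l|, and |z| ≤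
-- (ε + z²/ε)/2 brings in the variance of T^α/m, which is l²(1/c - 1) with c = `normalizedCoeff α β
-- 2`.
open MeasureTheory in
theorem abs_one_div_sub_normalized_mittagLeffler_le {α β l ε : ℝ} (hα : 0 < α) (hα1 : α ≤ 1)
    (hβ : α ≤ β) (hl : 0 < l) (hε : 0 < ε) :
    |1 / (1 + l) - Real.Gamma β * mittagLeffler α β (Real.Gamma (β + α) / Real.Gamma β * -l)|
      ≤ (ε + l ^ 2 * ((normalizedCoeff α β 2)⁻¹ - 1) / ε) / 2 := by
  have hβ0 := hα.trans_le hβ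
  have hG := Real.Gamma_pos_of_pos hβ0
  have hG1 := Real.Gamma_pos_of_pos (by positivity : 0 < β + α)
  have hG2 := Real.Gamma_pos_of_pos (by positivity : 0 < β + 2 * α)
  set m := Real.Gamma (β + α) / Real.Gamma β with hmdef
  have hm : 0 < m := by positivity
  set r : ℝ := l ^ (-α⁻¹) with hr
  have hr0 : 0 < r := by positivity
  have hrα : r ^ (-α) = l := by
    rw [hr, ← Real.rpow_mul hl.le, neg_mul_neg, inv_mul_cancel₀ hα.ne', Real.rpow_one]
  set K := r ^ β / Real.Gamma β with hK
  have hK0 : 0 < K := by positivity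
  set w : ℝ → ℝ → ℝ := fun c t => K * (t ^ (β + c - 1) * Real.exp (-(r * t))) with hw
  have hwint : ∀ c, 0 ≤ c → IntegrableOn (w c) (Set.Ioi 0) := fun c hc =>
    (integrableOn_rpow_mul_exp_neg_mul_Ioi (by positivity) hr0).const_mul K
  have hwval : ∀ c, 0 ≤ c → ∫ t in Set.Ioi (0 : ℝ), w c t
      = r ^ (-c) * (Real.Gamma (β + c) / Real.Gamma β) := by
    intro c hc
    rw [hw, integral_const_mul, Real.integral_rpow_mul_exp_neg_mul_Ioi (by positivity) hr0,
      one_div, Real.inv_rpow hr0.le, Real.rpow_add hr0, hK, Real.rpow_neg hr0.le]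
    field_simp
  have hw0 : ∫ t in Set.Ioi (0 : ℝ), w 0 t = 1 := by
    rw [hwval 0 le_rfl, neg_zero, Real.rpow_zero, add_zero, div_self hG.ne', one_mul]
  have hw1 : ∫ t in Set.Ioi (0 : ℝ), w α t = l * m := by rw [hwval α hα.le, hrα]
  have hw2 : ∫ t in Set.Ioi (0 : ℝ), w (2 * α) t
      = l ^ 2 * (Real.Gamma (β + 2 * α) / Real.Gamma β) := by
    rw [hwval (2 * α) (by positivity), show -(2 * α) = -α * (2 : ℕ) by push_cast; ring,
      Real.rpow_mul hr0.le, hrα, Real.rpow_natCast]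
  set A := Real.Gamma β * mittagLeffler α β (m * -l) with hA
  have hLint : IntegrableOn (fun t => K * Real.Gamma β * (t ^ (β - 1) * Real.exp (-(r * t)) *
      mittagLeffler α β (-t ^ α))) (Set.Ioi 0) :=
    (integrableOn_rpow_mul_exp_mul_mittagLeffler hα hα1 hβ hr0).const_mul _
  have hL : ∫ t in Set.Ioi (0 : ℝ), K * Real.Gamma β * (t ^ (β - 1) * Real.exp (-(r * t)) *
      mittagLeffler α β (-t ^ α)) = 1 / (1 + l) := by
    rw [integral_const_mul, laplace_mittagLeffler hα hα1 hβ hr0, hrα, hK, Real.rpow_neg hr0.le]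
    have := (Real.rpow_pos_of_pos hr0 β).ne'
    field_simp
  have hdiff : ∫ t in Set.Ioi (0 : ℝ), (K * Real.Gamma β * (t ^ (β - 1) * Real.exp (-(r * t)) *
      mittagLeffler α β (-t ^ α)) - A * w 0 t) = 1 / (1 + l) - A := by
    rw [integral_sub hLint ((hwint 0 le_rfl).const_mul A), hL, integral_const_mul, hw0, mul_one]
  -- The majorant (ε + (t^α/m - l)²/ε)/2 times the Gamma density, expanded so that only moments of
  -- order 0, α and 2α occur.
  set B : ℝ → ℝ := fun t => (ε + l ^ 2 / ε) / 2 * w 0 t - l / (m * ε) * w α t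
    + 1 / (2 * m ^ 2 * ε) * w (2 * α) t with hB
  have hB0 := (hwint 0 le_rfl).const_mul ((ε + l ^ 2 / ε) / 2)
  have hB1 := (hwint α hα.le).const_mul (l / (m * ε))
  have hB2 := (hwint (2 * α) (by positivity)).const_mul (1 / (2 * m ^ 2 * ε))
  have hBint : IntegrableOn B (Set.Ioi 0) := (hB0.sub hB1).add hB2
  have hBval : ∫ t in Set.Ioi (0 : ℝ), B t
      = (ε + l ^ 2 * ((normalizedCoeff α β 2)⁻¹ - 1) / ε) / 2 := by
    refine (integral_add (hB0.sub hB1) hB2).trans ?_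
    rw [integral_sub' hB0 hB1, integral_const_mul _ (w 0), integral_const_mul _ (w α),
      integral_const_mul _ (w (2 * α)), hw0, hw1, hw2, normalizedCoeff, gammaRatio,
      ← hmdef, Nat.cast_ofNat, mul_comm α 2]
    field_simp
    ring
  rw [← hdiff, ← hBval, ← Real.norm_eq_abs]
  refine norm_integral_le_of_norm_le hBint ?_
  filter_upwards [ae_restrict_mem measurableSet_Ioi] with t ht
  have ht0 : (0 : ℝ) < t := ht
  have hwα : w α t = w 0 t * t ^ α := by
    simp only [hw]
    rw [show β + α - 1 = β + 0 - 1 + α by ring, Real.rpow_add ht0]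
    ring
  have hw2α : w (2 * α) t = w 0 t * (t ^ α) ^ 2 := by
    simp only [hw]
    rw [show β + 2 * α - 1 = β + 0 - 1 + α + α by ring, Real.rpow_add ht0, Real.rpow_add ht0]
    ring
  have hw0t : 0 ≤ w 0 t := by simp only [hw]; positivity
  have hlhs : K * Real.Gamma β * (t ^ (β - 1) * Real.exp (-(r * t)) *
      mittagLeffler α β (-t ^ α)) - A * w 0 t
      = w 0 t * (Real.Gamma β * (mittagLeffler α β (-t ^ α) - mittagLeffler α β (m * -l))) := by
    simp only [hw, hA, add_zero]
    ring
  have hBt : B t = w 0 t * ((ε + (t ^ α / m - l) ^ 2 / ε) / 2) := by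
    simp only [hB, hwα, hw2α]
    field_simp
    ring
  rw [hlhs, hBt, Real.norm_eq_abs, abs_mul (w 0 t), abs_mul (Real.Gamma β),
    abs_of_nonneg hw0t, abs_of_pos hG]
  refine mul_le_mul_of_nonneg_left ?_ hw0t
  have hlip := abs_mittagLeffler_sub_le hα hα1 hβ (x := -t ^ α) (y := m * -l)
    (neg_nonpos.mpr (by positivity)) (by nlinarith)
  have hstep : Real.Gamma β * (|-t ^ α - m * -l| / Real.Gamma (β + α)) = |t ^ α / m - l| := by
    have e : -t ^ α - m * -l = -(m * (t ^ α / m - l)) := by field_simp; ring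
    rw [e, abs_neg, abs_mul, abs_of_pos hm, hmdef]
    field_simp
  refine (mul_le_mul_of_nonneg_left hlip hG.le).trans (hstep.trans_le ?_)
  set z := |t ^ α / m - l|
  rw [← sq_abs (t ^ α / m - l)]
  have h2 : 2 * z * ε ≤ ε ^ 2 + z ^ 2 := by nlinarith [sq_nonneg (ε - z)]
  rw [le_div_iff₀ two_pos, ← sub_nonneg]
  have e : ε + z ^ 2 / ε - z * 2 = (ε ^ 2 + z ^ 2 - 2 * z * ε) / ε := by field_simp
  rw [e]
  exact div_nonneg (by linarith) hε.le

theorem tendsto_normalized_mittagLeffler_of_neg {α x : ℝ} (hα : 0 < α) (hα1 : α ≤ 1)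
    (hx : x < 0) :
    Filter.Tendsto (fun β : ℝ =>
      Real.Gamma β * mittagLeffler α β (Real.Gamma (β + α) / Real.Gamma β * x))
      Filter.atTop (nhds (1 / (1 - x))) := by
  rw [Metric.tendsto_nhds]
  intro ε hε
  have hlim : Filter.Tendsto (fun β => (-x) ^ 2 * ((normalizedCoeff α β 2)⁻¹ - 1))
      Filter.atTop (nhds 0) := by
    have h := (((tendsto_normalizedCoeff hα.le 2).inv₀ one_ne_zero).sub_const 1).const_mul
      ((-x) ^ 2)
    rwa [inv_one, sub_self, mul_zero] at h
  -- The target accuracy ε also serves as the free parameter of the estimate: (ε + δ/ε)/2 < ε once δ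
  -- < ε².
  filter_upwards [hlim.eventually (gt_mem_nhds (by positivity : 0 < ε ^ 2)),
    Filter.eventually_ge_atTop α] with β h1 hβ
  have h := abs_one_div_sub_normalized_mittagLeffler_le hα hα1 hβ (neg_pos.mpr hx) hε
  rw [neg_neg, ← sub_eq_add_neg] at h
  rw [dist_comm, Real.dist_eq]
  refine h.trans_lt ?_
  have h2 : (-x) ^ 2 * ((normalizedCoeff α β 2)⁻¹ - 1) / ε < ε := by
    rw [div_lt_iff₀ hε]
    linarith
  linarith

theorem theoremD (α : ℝ) (hα : α ∈ Set.Ioc (0 : ℝ) 1) (x : ℝ) (hx : x ≠ 0) :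
    StrictMonoOn
        (fun β : ℝ =>
          Real.Gamma β * mittagLeffler α β (Real.Gamma (β + α) / Real.Gamma β * x))
        (Set.Ioi α) ∧
      (1 ≤ x →
        Filter.Tendsto
          (fun β : ℝ =>
            Real.Gamma β * mittagLeffler α β (Real.Gamma (β + α) / Real.Gamma β * x))
          Filter.atTop Filter.atTop) ∧
      (x < 1 →
        Filter.Tendsto
          (fun β : ℝ =>
            Real.Gamma β * mittagLeffler α β (Real.Gamma (β + α) / Real.Gamma β * x))
          Filter.atTop (nhds (1 / (1 - x)))) := by
  refine ⟨strictMonoOn_normalized_mittagLeffler hα.1 hα.2 hx,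
    tendsto_normalized_mittagLeffler_atTop hα.1, fun hx1 => ?_⟩
  rcases hx.lt_or_gt with hneg | hpos
  · exact tendsto_normalized_mittagLeffler_of_neg hα.1 hα.2 hneg
  · exact tendsto_normalized_mittagLeffler_of_abs_lt_one hα.1 (by rwa [abs_of_pos hpos])
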